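/- Let $\mathcal{C}$ be a triangulated category with shift $[1]$. For full subcategories $\mathcal{X},\mathcal{Y}\subseteq\mathcal{C}$, let $\mathcal{X}*\mathcal{Y}$, $\mathsf{Cone}(\mathcal{X},\mathcal{Y})$ and $\mathsf{CoCone}(\mathcal{X},\mathcal{Y})$ be the full subcategories of all objects $E$ that occur in a distinguished triangle $X\to E\to Y\to X[1]$, $X\to Y\to E\to X[1]$, respectively $E\to X\to Y\to E[1]$, with $X\in\mathcal{X}$ and $Y\in\mathcal{Y}$, and let $\mathsf{add}\,\mathcal{X}$ be the full subcategory of all direct summands of finite direct sums of objects of $\mathcal{X}$. Let $(\mathcal{U},\mathcal{V})$ be a cotorsion pair in $\mathcal{C}$, that is, a pair of full additive subcategories closed under isomorphisms and direct summands such that $\mathcal{C}(U,V[1])=0$ for all $U\in\mathcal{U}$, $V\in\mathcal{V}$, and $\mathsf{Cone}(\mathcal{V},\mathcal{U})=\mathcal{C}=\mathsf{CoCone}(\mathcal{V},\mathcal{U})$. Put $\mathcal{W}=\mathcal{U}\cap\mathcal{V}$, $\mathcal{C}^-=\mathcal{U}[-1]*\mathcal{W}$, $\mathcal{C}^+=\mathcal{W}*\mathcal{V}[1]$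 and $\mathcal{H}=\mathcal{C}^+\cap\mathcal{C}^-$. Let $\pi:\mathcal{C}\to\mathcal{C}/[\mathcal{W}]$ be the quotient by the ideal of morphisms that factor through an object of $\mathcal{W}$; the images $\mathcal{C}^\pm/[\mathcal{W}]$ and the heart $\mathcal{H}/[\mathcal{W}]$ are full subcategories of $\mathcal{C}/[\mathcal{W}]$. Let $R:\mathcal{C}/[\mathcal{W}]\to\mathcal{C}^+/[\mathcal{W}]$, $X\mapsto X^+$, be the left adjoint of the inclusion, where $X\to X^+$ comes from a distinguished triangle $U_X[-1]\to X\to X^+\to U_X$ with $X^+\in\mathcal{C}^+$, $U_X\in\mathcal{U}$, whose first map factors through an object of $\mathcal{U}$. Dually, let $L:\mathcal{C}/[\mathcal{W}]\to\mathcal{C}^- /[\mathcal{W}]$, $X\mapsto X^-$, be the right adjoint of the inclusion, where $X^-\to X$ comes from a distinguished triangle $V_X\to X^-\to X\to V_X[1]$ with $X^-\in\mathcal{C}^-$, $V_X\in\mathcal{V}$, whose last map factors through an object of $\mathcal{V}$. The functor $L$ restricts to $\mathcal{C}^+/[\mathcal{W}]\to\mathcal{H}/[\mathcal{W}]$; let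 $H=LR\pi:\mathcal{C}\to\mathcal{H}/[\mathcal{W}]$ and let $\mathcal{N}=\operatorname{Ker}H$ be the full subcategory of all $X$ with $H(X)=0$. Then: (1) $\mathcal{N}=\mathsf{add}(\mathcal{U}*\mathcal{V})$; in particular, $\mathsf{Cone}(\mathcal{N},\mathcal{N})=\mathcal{C}$. (2) For every morphism $f$ of $\mathcal{C}$, $H(f)=0$ if and only if $f$ factors through an object of $\mathcal{N}$. -/

import Mathlib

open CategoryTheory CategoryTheory.Limits CategoryTheory.Pretriangulated
open scoped ZeroObject

universe v u

namespace CategoryTheory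

section General

variable {C : Type u} [Category.{v} C] [Preadditive C]

/-- The full subcategory `add P`: direct summands of finite direct sums of objects of `P`. -/
def ObjectProperty.addClosure [HasFiniteBiproducts C] (P : ObjectProperty C) : ObjectProperty C :=
  fun X => ∃ (n : ℕ) (Y : Fin n → C), (∀ i, P (Y i)) ∧ Nonempty (Retract X (⨁ Y))

/-- A morphism `f` factors through an object of `P`. -/
def ObjectProperty.FactorsThrough (P : ObjectProperty C) {X Y : C} (f : X ⟶ Y) : Prop :=
  ∃ (Z : C) (_ : P Z) (a : X ⟶ Z) (b : Z ⟶ Y), a ≫ b = f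

/-- Two parallel morphisms are identified modulo the ideal `[P]` when their difference
factors through an object of `P`. -/
def ObjectProperty.idealRel (P : ObjectProperty C) : HomRel C :=
  fun _ _ f g => P.FactorsThrough (f - g)

lemma ObjectProperty.FactorsThrough.add [HasBinaryBiproducts C] {P : ObjectProperty C}
    (hP : ∀ X Y, P X → P Y → P (X ⊞ Y)) {X Y : C} {f g : X ⟶ Y}
    (hf : P.FactorsThrough f) (hg : P.FactorsThrough g) : P.FactorsThrough (f + g) := by
  obtain ⟨Z, hZ, a, b, rfl⟩ := hf
  obtain ⟨Z', hZ', a', b', rfl⟩ := hg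
  exact ⟨Z ⊞ Z', hP _ _ hZ hZ', biprod.lift a a', biprod.desc b b', by simp⟩

lemma ObjectProperty.FactorsThrough.neg {P : ObjectProperty C} {X Y : C} {f : X ⟶ Y}
    (hf : P.FactorsThrough f) : P.FactorsThrough (-f) := by
  obtain ⟨Z, hZ, a, b, rfl⟩ := hf
  exact ⟨Z, hZ, -a, b, by simp⟩

lemma ObjectProperty.congruence_idealRel [HasBinaryBiproducts C] {P : ObjectProperty C}
    (hP : ∀ X Y, P X → P Y → P (X ⊞ Y)) (hP₀ : ∃ Z, P Z) : Congruence P.idealRel where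
  comp_left f g g' := by
    rintro ⟨Z, hZ, a, b, h⟩
    exact ⟨Z, hZ, f ≫ a, b, by rw [Category.assoc, h, Preadditive.comp_sub]⟩
  comp_right g := by
    rintro ⟨Z, hZ, a, b, h⟩
    exact ⟨Z, hZ, a, b ≫ g, by rw [← Category.assoc, h, Preadditive.sub_comp]⟩
  equivalence :=
    { refl := fun f => by
        obtain ⟨Z, hZ⟩ := hP₀
        exact ⟨Z, hZ, 0, 0, by simp⟩
      symm := fun {f g} h => by
        have := h.neg
        rwa [neg_sub] at this
      trans := fun {f g k} h h' => by
        have := h.add hP h'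
        rwa [sub_add_sub_cancel] at this }

end General

section Triangulated

variable {C : Type u} [Category.{v} C] [HasZeroObject C] [HasShift C ℤ] [Preadditive C]
  [∀ n : ℤ, (shiftFunctor C n).Additive] [Pretriangulated C]

/-- `Cone(P, Q)`: the objects `X` in a distinguished triangle `A ⟶ B ⟶ X ⟶ A⟦1⟧`
with `A` in `P` and `B` in `Q`. -/
def ObjectProperty.coneOf (P Q : ObjectProperty C) : ObjectProperty C :=
  fun X => ∃ (A B : C) (_ : P A) (_ : Q B) (f : A ⟶ B) (g : B ⟶ X) (h : X ⟶ A⟦(1 : ℤ)⟧),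
    Triangle.mk f g h ∈ distTriang C

/-- `CoCone(P, Q)`: the objects `X` in a distinguished triangle `X ⟶ A ⟶ B ⟶ X⟦1⟧`
with `A` in `P` and `B` in `Q`. -/
def ObjectProperty.coconeOf (P Q : ObjectProperty C) : ObjectProperty C :=
  fun X => ∃ (A B : C) (_ : P A) (_ : Q B) (f : X ⟶ A) (g : A ⟶ B) (h : B ⟶ X⟦(1 : ℤ)⟧),
    Triangle.mk f g h ∈ distTriang C

section Exactness

variable {X Y Z : C} {a : X ⟶ Y} {b : Y ⟶ Z} {c : Z ⟶ X⟦(1 : ℤ)⟧}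

lemma distTriang_lift₁ (hT : Triangle.mk a b c ∈ distTriang C) {T : C} (f : T ⟶ Y)
    (hf : f ≫ b = 0) : ∃ g : T ⟶ X, f = g ≫ a :=
  Triangle.coyoneda_exact₂ _ hT f hf

lemma distTriang_lift₂ (hT : Triangle.mk a b c ∈ distTriang C) {T : C} (f : T ⟶ Z)
    (hf : f ≫ c = 0) : ∃ g : T ⟶ Y, f = g ≫ b :=
  Triangle.coyoneda_exact₃ _ hT f hf

lemma distTriang_desc₂ (hT : Triangle.mk a b c ∈ distTriang C) {T : C} (f : Y ⟶ T)
    (hf : a ≫ f = 0) : ∃ g : Z ⟶ T, f = b ≫ g :=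
  Triangle.yoneda_exact₂ _ hT f hf

lemma distTriang_desc₃ (hT : Triangle.mk a b c ∈ distTriang C) {T : C} (f : Z ⟶ T)
    (hf : b ≫ f = 0) : ∃ g : X⟦(1 : ℤ)⟧ ⟶ T, f = c ≫ g :=
  Triangle.yoneda_exact₃ _ hT f hf

lemma distTriang_lift₀ (hT : Triangle.mk a b c ∈ distTriang C) {T : C} (f : T ⟶ X)
    (hf : f ≫ a = 0) : ∃ (g : T ⟶ Z⟦(-1 : ℤ)⟧) (d : Z⟦(-1 : ℤ)⟧ ⟶ X), f = g ≫ d := by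
  obtain ⟨g, hg⟩ := Triangle.coyoneda_exact₂ _ (inv_rot_of_distTriang _ hT) f hf
  exact ⟨g, _, hg⟩

lemma distTriang_shift_lift₁ (hT : Triangle.mk a b c ∈ distTriang C) {T : C}
    (f : T ⟶ Y⟦(1 : ℤ)⟧) (hf : f ≫ b⟦(1 : ℤ)⟧' = 0) :
    ∃ g : T ⟶ X⟦(1 : ℤ)⟧, f = g ≫ a⟦(1 : ℤ)⟧' := by
  obtain ⟨g, hg⟩ := Triangle.coyoneda_exact₁ _ (rot_of_distTriang _ hT) f hf
  refine ⟨-g, hg.trans ?_⟩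
  exact (Preadditive.comp_neg _ _).trans (Preadditive.neg_comp _ _).symm

lemma distTriang_retraction (hT : Triangle.mk a b c ∈ distTriang C) (hc : c = 0) :
    ∃ r : Y ⟶ X, a ≫ r = 𝟙 X := by
  have : Mono a := Triangle.mono₁ _ hT hc
  have : IsSplitMono a := isSplitMono_of_mono a
  exact ⟨retraction a, IsSplitMono.id a⟩

end Exactness

variable (C) in
/-- A cotorsion pair `(U, V)` in a triangulated category. The conditions force `U` and `V` to be
closed under finite direct sums, so this is not required separately. -/
structure CotorsionPair where
  /-- the first class -/
  U : ObjectProperty C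
  /-- the second class -/
  V : ObjectProperty C
  /-- `U` is closed under direct summands (in particular under isomorphisms) -/
  stableU : U.IsStableUnderRetracts
  /-- `V` is closed under direct summands (in particular under isomorphisms) -/
  stableV : V.IsStableUnderRetracts
  /-- `𝔼(U, V) = Hom(U, V⟦1⟧) = 0` -/
  ext_zero : ∀ ⦃A B : C⦄, U A → V B → ∀ f : A ⟶ B⟦(1 : ℤ)⟧, f = 0
  /-- `Cone(V, U) = C` -/
  coneOf_eq_top : V.coneOf U = ⊤
  /-- `CoCone(V, U) = C` -/
  coconeOf_eq_top : V.coconeOf U = ⊤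

namespace CotorsionPair

attribute [instance] CotorsionPair.stableU CotorsionPair.stableV

variable (t : CotorsionPair C)

/-- `W = U ∩ V`. -/
def W : ObjectProperty C := t.U ⊓ t.V

/-- `U[-1]`, the objects `X` such that `X⟦1⟧` is in `U`. -/
def Um : ObjectProperty C := t.U.shift (1 : ℤ)

/-- `V[1]`, the objects `X` such that `X⟦-1⟧` is in `V`. -/
def Vp : ObjectProperty C := t.V.shift (-1 : ℤ)

/-- `C⁻ = U[-1] * W`. -/
def minus : ObjectProperty C := ObjectProperty.extensionProduct t.Um t.W

/-- `C⁺ = W * V[1]`. -/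
def plus : ObjectProperty C := ObjectProperty.extensionProduct t.W t.Vp

lemma exists_cone (X : C) : ∃ (A B : C) (_ : t.V A) (_ : t.U B) (f : A ⟶ B) (g : B ⟶ X)
    (h : X ⟶ A⟦(1 : ℤ)⟧), Triangle.mk f g h ∈ distTriang C := by
  have : (t.V.coneOf t.U) X := by rw [t.coneOf_eq_top]; trivial
  exact this

lemma exists_cocone (X : C) : ∃ (A B : C) (_ : t.V A) (_ : t.U B) (f : X ⟶ A) (g : A ⟶ B)
    (h : B ⟶ X⟦(1 : ℤ)⟧), Triangle.mk f g h ∈ distTriang C := by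
  have : (t.V.coconeOf t.U) X := by rw [t.coconeOf_eq_top]; trivial
  exact this

lemma Vp_shift {B : C} (hB : t.V B) : t.Vp (B⟦(1 : ℤ)⟧) :=
  t.V.prop_of_iso ((shiftEquiv C (1 : ℤ)).unitIso.app B) hB

lemma Um_shift {A : C} (hA : t.U A) : t.Um (A⟦(-1 : ℤ)⟧) :=
  t.U.prop_of_iso ((shiftEquiv C (1 : ℤ)).counitIso.symm.app A) hA

lemma zero_of_U_Vp {A B : C} (hA : t.U A) (hB : t.Vp B) (f : A ⟶ B) : f = 0 := by
  have := t.ext_zero hA hB (f ≫ (shiftEquiv C (1 : ℤ)).counitIso.inv.app B)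
  exact (cancel_mono ((shiftEquiv C (1 : ℤ)).counitIso.inv.app B)).1 (this.trans zero_comp.symm)

lemma zero_of_Um_V {A B : C} (hA : t.Um A) (hB : t.V B) (f : A ⟶ B) : f = 0 :=
  (shiftFunctor C (1 : ℤ)).map_injective (by
    rw [Functor.map_zero]
    exact t.ext_zero hA hB _)

lemma U_of_zero {X : C} (h : ∀ B, t.V B → ∀ f : X ⟶ B⟦(1 : ℤ)⟧, f = 0) : t.U X := by
  obtain ⟨A, B, hA, hB, a, b, c, hT⟩ := t.exists_cone X
  obtain ⟨s, hs⟩ := distTriang_lift₂ hT (𝟙 X) (by rw [h A hA c, comp_zero])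
  exact t.U.prop_of_retract { i := s, r := b, retract := hs.symm } hB

lemma V_of_zero {X : C} (h : ∀ A, t.U A → ∀ f : A ⟶ X⟦(1 : ℤ)⟧, f = 0) : t.V X := by
  obtain ⟨A, B, hA, hB, a, b, c, hT⟩ := t.exists_cocone X
  obtain ⟨r, hr⟩ := distTriang_retraction hT (h B hB c)
  exact t.V.prop_of_retract { i := a, r := r, retract := hr } hA

lemma U_ext (T : Triangle C) (hT : T ∈ distTriang C) (h₁ : t.U T.obj₁) (h₃ : t.U T.obj₃) :
    t.U T.obj₂ :=
  t.U_of_zero (fun B hB f => by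
    obtain ⟨g, rfl⟩ := Triangle.yoneda_exact₂ _ hT f (t.ext_zero h₁ hB _)
    rw [t.ext_zero h₃ hB g, comp_zero])

lemma V_ext (T : Triangle C) (hT : T ∈ distTriang C) (h₁ : t.V T.obj₁) (h₃ : t.V T.obj₃) :
    t.V T.obj₂ :=
  t.V_of_zero (fun A hA f => by
    obtain ⟨g, rfl⟩ := distTriang_shift_lift₁ (a := T.mor₁) (b := T.mor₂) (c := T.mor₃) hT f
      (t.ext_zero hA h₃ _)
    rw [t.ext_zero hA h₁ g, zero_comp])

lemma W_biprod (X Y : C) (hX : t.W X) (hY : t.W Y) : t.W (X ⊞ Y) :=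
  ⟨t.U_ext _ (binaryBiproductTriangle_distinguished X Y) hX.1 hY.1,
    t.V_ext _ (binaryBiproductTriangle_distinguished X Y) hX.2 hY.2⟩

lemma U_zero : t.U 0 := t.U_of_zero (fun _ _ _ => (isZero_zero C).eq_of_src _ _)

lemma V_zero : t.V 0 := t.V_of_zero (fun _ _ f => by
  obtain h := (shiftFunctor C (1 : ℤ)).map_isZero (isZero_zero C)
  exact h.eq_of_tgt _ _)

instance : t.V.ContainsZero := ⟨⟨0, isZero_zero C, t.V_zero⟩⟩

instance : t.Vp.ContainsZero :=
  ⟨⟨0, isZero_zero C, t.V.prop_of_iso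
    ((isZero_zero C).iso ((shiftFunctor C (-1 : ℤ)).map_isZero (isZero_zero C))) t.V_zero⟩⟩

instance : t.Um.ContainsZero :=
  ⟨⟨0, isZero_zero C, t.U.prop_of_iso
    ((isZero_zero C).iso ((shiftFunctor C (1 : ℤ)).map_isZero (isZero_zero C))) t.U_zero⟩⟩

lemma W_le_plus : t.W ≤ t.plus := ObjectProperty.le_extensionProduct_left _

lemma W_le_minus : t.W ≤ t.minus := ObjectProperty.le_extensionProduct_right _

lemma V_le_plus : t.V ≤ t.plus := fun X hX => by
  obtain ⟨V₁, W₁, hV₁, hW₁, a, b, c, hT⟩ := t.exists_cone X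
  exact ⟨_, _, _, _, _, rot_of_distTriang _ hT, ⟨hW₁, t.V_ext _ hT hV₁ hX⟩, t.Vp_shift hV₁⟩

instance : Congruence t.W.idealRel :=
  ObjectProperty.congruence_idealRel t.W_biprod ⟨0, t.U_zero, t.V_zero⟩

/-- The additive quotient `C/[W]`. -/
abbrev AddQuotient : Type u := CategoryTheory.Quotient t.W.idealRel

noncomputable instance : Preadditive t.AddQuotient :=
  CategoryTheory.Quotient.preadditive _ (fun _ _ f₁ f₂ g₁ g₂ hf hg => by
    have := ObjectProperty.FactorsThrough.add t.W_biprod hf hg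
    rwa [← add_sub_add_comm] at this)

/-- The quotient functor `π : C ⥤ C/[W]`. -/
abbrev π : C ⥤ t.AddQuotient := CategoryTheory.Quotient.functor _

lemma π_map_eq_iff {X Y : C} (f g : X ⟶ Y) :
    t.π.map f = t.π.map g ↔ t.W.FactorsThrough (f - g) :=
  CategoryTheory.Quotient.functor_map_eq_iff _ f g

/-- The objects of `C⁺/[W]`, as a full subcategory of `C/[W]`. -/
def plusQ : ObjectProperty t.AddQuotient := fun X => t.plus X.as

/-- The objects of `C⁻/[W]`, as a full subcategory of `C/[W]`. -/
def minusQ : ObjectProperty t.AddQuotient := fun X => t.minus X.as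

/-- The objects of the heart: `C⁺ ∩ C⁻`. -/
def heartQ : ObjectProperty t.AddQuotient := t.plusQ ⊓ t.minusQ

/-- The heart `ℋ/[W]`, where `ℋ = C⁺ ∩ C⁻`, as a full subcategory of `C/[W]`. (As `W ⊆ ℋ`, a
morphism between objects of `ℋ` lies in the ideal `[W]` of `ℋ` if and only if it lies in the
ideal `[W]` of `C`, so the quotient of `ℋ` is a full subcategory of the quotient of `C`.) -/
abbrev Heart : Type u := t.heartQ.FullSubcategory

/-- A reflection triangle `A ⟶ X ⟶ X⁺ ⟶ A⟦1⟧` of `X`: here `A` is in `U[-1]`, the first map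
factors through an object of `U`, and `X⁺` is in `C⁺`. -/
structure ReflectionTriangle (X : C) where
  /-- an object of `U[-1]` -/
  A : C
  /-- an object of `U` -/
  U' : C
  /-- the reflection `X⁺` -/
  obj : C
  hA : t.Um A
  hU' : t.U U'
  hobj : t.plus obj
  /-- first part of the map `A ⟶ X` -/
  d : A ⟶ U'
  /-- second part of the map `A ⟶ X` -/
  s : U' ⟶ X
  /-- the approximation `X ⟶ X⁺` -/
  β : X ⟶ obj
  /-- the connecting map -/
  δ : obj ⟶ A⟦(1 : ℤ)⟧
  dist : Triangle.mk (d ≫ s) β δ ∈ distTriang C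

/-- A coreflection triangle `X⁻ ⟶ X ⟶ B ⟶ X⁻⟦1⟧` of `X`: here `B` is in `V[1]`, the map `X ⟶ B`
factors through an object of `V`, and `X⁻` is in `C⁻`. -/
structure CoreflectionTriangle (X : C) where
  /-- an object of `V[1]` -/
  B : C
  /-- an object of `V` -/
  V' : C
  /-- the coreflection `X⁻` -/
  obj : C
  hB : t.Vp B
  hV' : t.V V'
  hobj : t.minus obj
  /-- first part of the map `X ⟶ B` -/
  s : X ⟶ V'
  /-- second part of the map `X ⟶ B` -/
  d : V' ⟶ B
  /-- the approximation `X⁻ ⟶ X` -/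
  α : obj ⟶ X
  /-- the connecting map -/
  δ : B ⟶ obj⟦(1 : ℤ)⟧
  dist : Triangle.mk α (s ≫ d) δ ∈ distTriang C

variable {t} in
lemma ReflectionTriangle.exists_fac {X : C} (r : t.ReflectionTriangle X) {Y : C}
    (hY : t.plus Y) (f : X ⟶ Y) : ∃ g : r.obj ⟶ Y, r.β ≫ g = f := by
  obtain ⟨W₁, B, a, b, c, hT, hW, hB⟩ := hY
  obtain ⟨k, hk⟩ := distTriang_lift₁ hT (r.s ≫ f) (t.zero_of_U_Vp r.hU' hB _)
  obtain ⟨g, hg⟩ := distTriang_desc₂ r.dist f (by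
    have h0 : r.d ≫ k = 0 := t.zero_of_Um_V r.hA hW.2 _
    rw [Category.assoc, hk, reassoc_of% h0, zero_comp])
  exact ⟨g, hg.symm⟩

variable {t} in
lemma ReflectionTriangle.factorsThrough {X : C} (r : t.ReflectionTriangle X) {Y : C}
    (hY : t.plus Y) (g : r.obj ⟶ Y) (h : t.W.FactorsThrough (r.β ≫ g)) :
    t.W.FactorsThrough g := by
  obtain ⟨Z, hZ, a, b, hab⟩ := h
  obtain ⟨a', rfl⟩ := r.exists_fac (t.W_le_plus _ hZ) a
  obtain ⟨k, hk⟩ := distTriang_desc₃ r.dist (g - a' ≫ b) (by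
    rw [Preadditive.comp_sub, ← hab, Category.assoc, sub_self])
  obtain ⟨W₁, B, i, p, c, hT, hW, hB⟩ := hY
  obtain ⟨l, rfl⟩ := distTriang_lift₁ hT k (t.zero_of_U_Vp r.hA hB _)
  have h₂ : t.W.FactorsThrough (g - a' ≫ b) := ⟨_, hW, r.δ ≫ l, i, by rw [hk, Category.assoc]⟩
  have := h₂.add t.W_biprod ⟨Z, hZ, a', b, rfl⟩
  rwa [sub_add_cancel] at this

variable {t} in
lemma CoreflectionTriangle.exists_fac {X : C} (r : t.CoreflectionTriangle X) {Y : C}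
    (hY : t.minus Y) (f : Y ⟶ X) : ∃ g : Y ⟶ r.obj, g ≫ r.α = f := by
  obtain ⟨A, W₁, a, b, c, hT, hA, hW⟩ := hY
  obtain ⟨k, hk⟩ := distTriang_desc₂ hT (f ≫ r.s) (t.zero_of_Um_V hA r.hV' _)
  obtain ⟨g, hg⟩ := distTriang_lift₁ r.dist f (by
    have h0 : k ≫ r.d = 0 := t.zero_of_U_Vp hW.1 r.hB _
    rw [← Category.assoc, hk, Category.assoc, h0, comp_zero])
  exact ⟨g, hg.symm⟩

variable {t} in
lemma CoreflectionTriangle.factorsThrough {X : C} (r : t.CoreflectionTriangle X) {Y : C}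
    (hY : t.minus Y) (g : Y ⟶ r.obj) (h : t.W.FactorsThrough (g ≫ r.α)) :
    t.W.FactorsThrough g := by
  obtain ⟨Z, hZ, a, b, hab⟩ := h
  obtain ⟨b', rfl⟩ := r.exists_fac (t.W_le_minus _ hZ) b
  obtain ⟨k, e, hk⟩ := distTriang_lift₀ r.dist (g - a ≫ b') (by
    rw [Preadditive.sub_comp, ← hab, Category.assoc, sub_self])
  obtain ⟨A, W₁, i, p, c, hT, hA, hW⟩ := hY
  obtain ⟨l, rfl⟩ := distTriang_desc₂ hT k (t.zero_of_Um_V hA r.hB _)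
  have h₂ : t.W.FactorsThrough (g - a ≫ b') := ⟨_, hW, p, l ≫ e, by rw [hk, Category.assoc]⟩
  have := h₂.add t.W_biprod ⟨Z, hZ, a, b', rfl⟩
  rwa [sub_add_cancel] at this

end CotorsionPair

end Triangulated

section Octahedral

variable {C : Type u} [Category.{v} C] [HasZeroObject C] [HasShift C ℤ] [Preadditive C]
  [∀ n : ℤ, (shiftFunctor C n).Additive] [Pretriangulated C] [IsTriangulated C]

namespace CotorsionPair

open Triangulated

variable (t : CotorsionPair C)

lemma nonempty_reflectionTriangle (X : C) : Nonempty (t.ReflectionTriangle X) := by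
  obtain ⟨V', U', hV', hU', f, g, h, hT⟩ := t.exists_cone X
  obtain ⟨W₁, U₁, hW₁, hU₁, a, b, c, hT'⟩ := t.exists_cocone U'
  have hW : t.W W₁ := ⟨t.U_ext _ hT' hU' hU₁, hW₁⟩
  have hT'' := inv_rot_of_distTriang _ hT'
  obtain ⟨Y, β, δ, hY⟩ := distinguished_cocone_triangle
    ((Triangle.mk a b c).invRotate.mor₁ ≫ g)
  let o := someOctahedron rfl hT'' (rot_of_distTriang _ hT) hY
  exact ⟨{ A := _, U' := U', obj := Y, hA := t.Um_shift hU₁, hU' := hU'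
           hobj := ⟨_, _, _, _, _, o.mem, hW, t.Vp_shift hV'⟩
           d := _, s := g, β := β, δ := δ, dist := hY }⟩

lemma nonempty_coreflectionTriangle (X : C) : Nonempty (t.CoreflectionTriangle X) := by
  obtain ⟨V', U', hV', hU', f, g, h, hT⟩ := t.exists_cocone X
  obtain ⟨V₁, W₁, hV₁, hW₁, a, b, c, hT'⟩ := t.exists_cone V'
  have hW : t.W W₁ := ⟨hW₁, t.V_ext _ hT' hV₁ hV'⟩
  obtain ⟨Y, α, δ, hY⟩ := distinguished_cocone_triangle₁ (f ≫ c)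
  let o := someOctahedron' rfl (inv_rot_of_distTriang _ hT) (rot_of_distTriang _ hT') hY
  exact ⟨{ B := _, V' := V', obj := Y, hB := t.Vp_shift hV₁, hV' := hV'
           hobj := ⟨_, _, _, _, _, o.mem, t.Um_shift hU', hW⟩
           s := f, d := c, α := α, δ := δ, dist := hY }⟩

/-- A chosen reflection triangle. -/
noncomputable def refl (X : C) : t.ReflectionTriangle X :=
  (t.nonempty_reflectionTriangle X).some

/-- A chosen coreflection triangle. -/
noncomputable def corefl (X : C) : t.CoreflectionTriangle X :=
  (t.nonempty_coreflectionTriangle X).some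

lemma V_ext_plus_le : ObjectProperty.extensionProduct t.V t.plus ≤ t.plus := by
  have h₁ : ObjectProperty.extensionProduct t.V t.W ≤ t.V := by
    rintro X ⟨A, B, f, g, h, hT, hA, hB⟩
    exact t.V_ext _ hT hA hB.2
  have h₂ : ObjectProperty.extensionProduct t.Vp t.Vp ≤ t.Vp := by
    rintro X ⟨A, B, f, g, h, hT, hA, hB⟩
    exact t.V_ext _ (Triangle.shift_distinguished _ hT (-1)) hA hB
  calc
    _ = ObjectProperty.extensionProduct (ObjectProperty.extensionProduct t.V t.W) t.Vp :=
        (ObjectProperty.extensionProduct_assoc _ _ _).symm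
    _ ≤ ObjectProperty.extensionProduct t.V t.Vp :=
        ObjectProperty.monotone_extensionProduct_left _ h₁
    _ ≤ ObjectProperty.extensionProduct t.plus t.Vp :=
        ObjectProperty.monotone_extensionProduct_left _ t.V_le_plus
    _ = ObjectProperty.extensionProduct t.W (ObjectProperty.extensionProduct t.Vp t.Vp) :=
        ObjectProperty.extensionProduct_assoc _ _ _
    _ ≤ _ := ObjectProperty.monotone_extensionProduct_right _ h₂

variable {t} in
lemma CoreflectionTriangle.plus_obj {X : C} (r : t.CoreflectionTriangle X) (hX : t.plus X) :
    t.plus r.obj :=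
  t.V_ext_plus_le _ ⟨_, _, _, _, _, inv_rot_of_distTriang _ r.dist, r.hB, hX⟩

/-- The object `X⁺` of `C⁺/[W]`, from the chosen reflection triangle of `X`. -/
noncomputable def plusObj (X : t.AddQuotient) : t.plusQ.FullSubcategory :=
  ⟨t.π.obj (t.refl X.as).obj, (t.refl X.as).hobj⟩

/-- The object `X⁻` of `C⁻/[W]`, from the chosen coreflection triangle of `X`. -/
noncomputable def minusObj (X : t.AddQuotient) : t.minusQ.FullSubcategory :=
  ⟨t.π.obj (t.corefl X.as).obj, (t.corefl X.as).hobj⟩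

/-- The class in `C/[W]` of `X ⟶ X⁺`. -/
noncomputable def βQ (X : t.AddQuotient) : X ⟶ (t.plusObj X).obj :=
  t.π.map (t.refl X.as).β

/-- The class in `C/[W]` of `X⁻ ⟶ X`. -/
noncomputable def αQ (X : t.AddQuotient) : (t.minusObj X).obj ⟶ X :=
  t.π.map (t.corefl X.as).α

lemma βQ_bijective (X : t.AddQuotient) (Y : t.plusQ.FullSubcategory) :
    Function.Bijective (fun g : t.plusObj X ⟶ Y => t.βQ X ≫ t.plusQ.ι.map g) := by
  constructor
  · rintro ⟨g₁⟩ ⟨g₂⟩ h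
    obtain ⟨g₁, rfl⟩ := t.π.map_surjective g₁
    obtain ⟨g₂, rfl⟩ := t.π.map_surjective g₂
    have h' : t.π.map ((t.refl X.as).β ≫ g₁) = t.π.map ((t.refl X.as).β ≫ g₂) := h
    rw [π_map_eq_iff, ← Preadditive.comp_sub] at h'
    have := (t.π_map_eq_iff _ _).2 ((t.refl X.as).factorsThrough Y.property _ h')
    exact congrArg _ this
  · intro f
    obtain ⟨f, rfl⟩ := t.π.map_surjective f
    obtain ⟨g, hg⟩ := (t.refl X.as).exists_fac Y.property f
    exact ⟨⟨t.π.map g⟩, congrArg t.π.map hg⟩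

lemma αQ_bijective (Y : t.minusQ.FullSubcategory) (X : t.AddQuotient) :
    Function.Bijective (fun g : Y ⟶ t.minusObj X => t.minusQ.ι.map g ≫ t.αQ X) := by
  constructor
  · rintro ⟨g₁⟩ ⟨g₂⟩ h
    obtain ⟨g₁, rfl⟩ := t.π.map_surjective g₁
    obtain ⟨g₂, rfl⟩ := t.π.map_surjective g₂
    have h' : t.π.map (g₁ ≫ (t.corefl X.as).α) = t.π.map (g₂ ≫ (t.corefl X.as).α) := h
    rw [π_map_eq_iff, ← Preadditive.sub_comp] at h'
    have := (t.π_map_eq_iff _ _).2 ((t.corefl X.as).factorsThrough Y.property _ h')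
    exact congrArg _ this
  · intro f
    obtain ⟨f, rfl⟩ := t.π.map_surjective f
    obtain ⟨g, hg⟩ := (t.corefl X.as).exists_fac Y.property f
    exact ⟨⟨t.π.map g⟩, congrArg t.π.map hg⟩

/-- `Hom(X⁺, Y) ≃ Hom(X, Y)` in `C/[W]` for `Y` in `C⁺`, by composition with `X ⟶ X⁺`. -/
noncomputable def reflEquiv (X : t.AddQuotient) (Y : t.plusQ.FullSubcategory) :
    (t.plusObj X ⟶ Y) ≃ (X ⟶ t.plusQ.ι.obj Y) :=
  Equiv.ofBijective _ (t.βQ_bijective X Y)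

/-- `Hom(Y, X) ≃ Hom(Y, X⁻)` in `C/[W]` for `Y` in `C⁻`, by composition with `X⁻ ⟶ X`. -/
noncomputable def coreflEquiv (Y : t.minusQ.FullSubcategory) (X : t.AddQuotient) :
    (t.minusQ.ι.obj Y ⟶ X) ≃ (Y ⟶ t.minusObj X) :=
  (Equiv.ofBijective _ (t.αQ_bijective Y X)).symm

lemma reflEquiv_naturality (X : t.AddQuotient) (Y Y' : t.plusQ.FullSubcategory) (g : Y ⟶ Y')
    (h : t.plusObj X ⟶ Y) :
    t.reflEquiv X Y' (h ≫ g) = t.reflEquiv X Y h ≫ t.plusQ.ι.map g := by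
  change t.βQ X ≫ t.plusQ.ι.map (h ≫ g) = (t.βQ X ≫ t.plusQ.ι.map h) ≫ t.plusQ.ι.map g
  rw [Functor.map_comp, Category.assoc]

lemma coreflEquiv_naturality (Y' Y : t.minusQ.FullSubcategory) (X : t.AddQuotient) (f : Y' ⟶ Y)
    (g : t.minusQ.ι.obj Y ⟶ X) :
    t.coreflEquiv Y' X (t.minusQ.ι.map f ≫ g) = f ≫ t.coreflEquiv Y X g := by
  obtain ⟨g, rfl⟩ := (t.coreflEquiv Y X).symm.surjective g
  rw [Equiv.apply_symm_apply, ← Equiv.eq_symm_apply]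
  change t.minusQ.ι.map f ≫ t.minusQ.ι.map g ≫ t.αQ X = t.minusQ.ι.map (f ≫ g) ≫ t.αQ X
  rw [Functor.map_comp, Category.assoc]

/-- The functor `R : C/[W] ⥤ C⁺/[W]`, `X ↦ X⁺`, adjoint to the inclusion. -/
noncomputable def R : t.AddQuotient ⥤ t.plusQ.FullSubcategory :=
  Adjunction.leftAdjointOfEquiv t.reflEquiv t.reflEquiv_naturality

/-- `R` is left adjoint to the inclusion `C⁺/[W] ⥤ C/[W]`. -/
noncomputable def adjR : t.R ⊣ t.plusQ.ι :=
  Adjunction.adjunctionOfEquivLeft t.reflEquiv t.reflEquiv_naturality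

/-- The functor `L : C/[W] ⥤ C⁻/[W]`, `X ↦ X⁻`, adjoint to the inclusion. -/
noncomputable def L : t.AddQuotient ⥤ t.minusQ.FullSubcategory :=
  Adjunction.rightAdjointOfEquiv t.coreflEquiv t.coreflEquiv_naturality

/-- `L` is right adjoint to the inclusion `C⁻/[W] ⥤ C/[W]`. -/
noncomputable def adjL : t.minusQ.ι ⊣ t.L :=
  Adjunction.adjunctionOfEquivRight t.coreflEquiv t.coreflEquiv_naturality

/-- The restriction `L : C⁺/[W] ⥤ ℋ/[W]`. -/
noncomputable def LPlus : t.plusQ.FullSubcategory ⥤ t.Heart :=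
  t.heartQ.lift (t.plusQ.ι ⋙ t.L ⋙ t.minusQ.ι) (fun X =>
    ⟨(t.corefl X.obj.as).plus_obj X.property, (t.corefl X.obj.as).hobj⟩)

/-- The functor `H = L ∘ R ∘ π : C ⥤ ℋ/[W]` associated to the cotorsion pair. -/
noncomputable def H : C ⥤ t.Heart := t.π ⋙ t.R ⋙ t.LPlus

end CotorsionPair

end Octahedral

end CategoryTheory

namespace CategoryTheory

namespace CotorsionPair

open Triangulated

variable {C : Type u} [Category.{v} C] [HasZeroObject C] [HasShift C ℤ] [Preadditive C]
  [∀ n : ℤ, (shiftFunctor C n).Additive] [Pretriangulated C]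

/-! ### Factorizations through `V` and `W` that need no octahedral axiom -/

section Pretriangulated

variable (t : CotorsionPair C)

/-! Everything rests on a criterion stated in `C` itself: `H(f) = 0` for `f : A ⟶ B` exactly when
the composite `A ⟶ B ⟶ B⁺` factors through `V` (`H_map_eq_zero_iff`). Indeed `R(f)` is the class of
some `g : A⁺ ⟶ B⁺`, and `L` kills `g` iff `g` restricted along the coreflection of `A⁺` lies in
`[W]`. This happens iff `g` factors through `V` (`factorsThrough_V_of_minus`,
`factorsThrough_W_of_minus`), and this can be tested on `A ⟶ A⁺` since `V ⊆ C⁺`.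

Given the criterion, `U * V` lies in the kernel because every map from `U * V` to `C⁺` factors
through `V` (`factorsThrough_V_of_UV`). Conversely, if `A ⟶ B ⟶ B⁺` factors through `V`, pulling
this factorization back along the reflection square of `B` makes `f` factor through `U * V`
(`factorsThrough_UV_of_plus`). This gives (2), and applied to an identity it exhibits each object of
the kernel as a summand of an object of `U * V`, hence (1). The cone statement is then `Cone(V, U) =
C` with `U, V ⊆ U * V`. -/

lemma V_biprod (X Y : C) (hX : t.V X) (hY : t.V Y) : t.V (X ⊞ Y) :=
  t.V_ext _ (binaryBiproductTriangle_distinguished X Y) hX hY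

instance : t.U.ContainsZero := ⟨⟨0, isZero_zero C, t.U_zero⟩⟩

/-- A morphism from an object of `C⁻` which factors through `V` also factors through `W`. -/
lemma factorsThrough_W_of_minus {Z Y : C} (hZ : t.minus Z) {f : Z ⟶ Y}
    (hf : t.V.FactorsThrough f) : t.W.FactorsThrough f := by
  obtain ⟨A, W₁, i, p, c, hT, hA, hW⟩ := hZ
  obtain ⟨V₁, hV₁, a, b, rfl⟩ := hf
  obtain ⟨k, rfl⟩ := distTriang_desc₂ hT a (t.zero_of_Um_V hA hV₁ _)
  exact ⟨W₁, hW, p, k ≫ b, by rw [Category.assoc]⟩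

/-- Every morphism from an object of `U * V` to an object of `C⁺` factors through `V`. -/
lemma factorsThrough_V_of_UV {X Y : C} (hX : t.U.extensionProduct t.V X) (hY : t.plus Y)
    (f : X ⟶ Y) : t.V.FactorsThrough f := by
  obtain ⟨U₁, V₁, u, v, w, hT, hU₁, hV₁⟩ := hX
  obtain ⟨W₁, B, j, p, c, hT', hW₁, hB⟩ := hY
  obtain ⟨k, hk⟩ := distTriang_lift₁ hT' (u ≫ f) (t.zero_of_U_Vp hU₁ hB _)
  -- Homotopy pushout of `U₁ ⟶ X ⟶ V₁` along `k`: the new middle term is an extension of `V₁` by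
  -- `W₁`, hence in `V`.
  obtain ⟨X', p', q, hX'⟩ := distinguished_cocone_triangle₂ (w ≫ k⟦(1 : ℤ)⟧')
  obtain ⟨m, hm₁, hm₂⟩ : ∃ m : X ⟶ X', u ≫ m = k ≫ p' ∧ v ≫ 𝟙 _ = m ≫ q :=
    complete_distinguished_triangle_morphism₂ _ _ hT hX' k (𝟙 _) (Category.id_comp _).symm
  have hwu : w ≫ u⟦(1 : ℤ)⟧' = 0 := comp_distTriang_mor_zero₃₁ _ hT
  -- The obstruction to extending `j` is `w` followed by the shift of `k ≫ j = u ≫ f`, and `w`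
  -- already kills the shift of `u`.
  obtain ⟨l, hl⟩ : ∃ l : X' ⟶ Y, j = p' ≫ l := by
    obtain ⟨l, hl⟩ : ∃ l : X'⟦(1 : ℤ)⟧ ⟶ Y⟦(1 : ℤ)⟧, j⟦(1 : ℤ)⟧' = (-p'⟦(1 : ℤ)⟧') ≫ l :=
      Triangle.yoneda_exact₃ _ (rot_of_distTriang _ hX') (j⟦(1 : ℤ)⟧') (by
        change (w ≫ k⟦(1 : ℤ)⟧') ≫ j⟦(1 : ℤ)⟧' = 0
        rw [Category.assoc, ← Functor.map_comp, ← hk, Functor.map_comp, reassoc_of% hwu,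
          zero_comp])
    obtain ⟨l, rfl⟩ := (shiftFunctor C (1 : ℤ)).map_surjective l
    exact ⟨-l, (shiftFunctor C (1 : ℤ)).map_injective (by simpa using hl)⟩
  obtain ⟨r, hr⟩ := distTriang_desc₂ hT (f - m ≫ l) (by
    rw [Preadditive.comp_sub, reassoc_of% hm₁, hk, hl, sub_self])
  refine ⟨X', t.V_ext _ hX' hW₁.2 hV₁, m, l + q ≫ r, ?_⟩
  rw [Category.comp_id] at hm₂
  rw [Preadditive.comp_add, ← Category.assoc, ← hm₂, ← hr, add_sub_cancel]

lemma π_map_eq_zero_iff {X Y : C} (f : X ⟶ Y) : t.π.map f = 0 ↔ t.W.FactorsThrough f := by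
  have h := t.π_map_eq_iff f 0
  rwa [sub_zero] at h

end Pretriangulated

variable [IsTriangulated C] (t : CotorsionPair C)

/-! ### Factorization criteria from the octahedra -/

/-- Associativity of `*` gives `U * (U * V) = (U * U) * V`, and `U` is closed under extensions. -/
lemma UV_biprod (X Y : C) (hX : t.U X) (hY : t.U.extensionProduct t.V Y) :
    t.U.extensionProduct t.V (X ⊞ Y) := by
  have h : t.U.extensionProduct (t.U.extensionProduct t.V) (X ⊞ Y) :=
    ⟨_, _, _, _, _, binaryBiproductTriangle_distinguished X Y, hX, hY⟩
  rw [← ObjectProperty.extensionProduct_assoc] at h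
  refine ObjectProperty.monotone_extensionProduct_left _ ?_ _ h
  rintro Z ⟨A, B, a, b, c, hT, hA, hB⟩
  exact t.U_ext _ hT hA hB

/-- A coreflection triangle of `X` together with the octahedron it is built from. -/
lemma exists_coreflection_square (X : C) :
    ∃ (A V₁ W₁ V' Z : C) (a : V₁ ⟶ W₁) (b : W₁ ⟶ V') (c : V' ⟶ V₁⟦(1 : ℤ)⟧) (s : X ⟶ V')
      (α : Z ⟶ X) (δ : V₁⟦(1 : ℤ)⟧ ⟶ Z⟦(1 : ℤ)⟧) (i : A ⟶ Z) (m : Z ⟶ W₁)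
      (e : W₁ ⟶ A⟦(1 : ℤ)⟧),
      t.Um A ∧ t.W W₁ ∧ t.V V' ∧ Triangle.mk a b c ∈ distTriang C ∧
      Triangle.mk α (s ≫ c) δ ∈ distTriang C ∧ Triangle.mk i m e ∈ distTriang C ∧
      m ≫ b = α ≫ s ∧ δ ≫ m⟦(1 : ℤ)⟧' = -a⟦(1 : ℤ)⟧' := by
  obtain ⟨V', U', hV', hU', s, p, h, hT⟩ := t.exists_cocone X
  obtain ⟨V₁, W₁, hV₁, hW₁, a, b, c, hT'⟩ := t.exists_cone V'
  obtain ⟨Z, α, δ, hZ⟩ := distinguished_cocone_triangle₁ (s ≫ c)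
  let o := someOctahedron' rfl (inv_rot_of_distTriang _ hT) (rot_of_distTriang _ hT') hZ
  exact ⟨_, V₁, W₁, V', Z, a, b, c, s, α, δ, _, _, _, t.Um_shift hU',
    ⟨hW₁, t.V_ext _ hT' hV₁ hV'⟩, hV', hT', hZ, o.mem, o.comm₄, o.comm₃⟩

/-- A reflection triangle of `X` together with the octahedron it is built from. -/
lemma exists_reflection_square (X : C) :
    ∃ (D U' W₁ B Z : C) (d : D ⟶ U') (a : U' ⟶ W₁) (w : W₁ ⟶ D⟦(1 : ℤ)⟧) (g : U' ⟶ X)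
      (β : X ⟶ Z) (δ : Z ⟶ D⟦(1 : ℤ)⟧) (m : W₁ ⟶ Z) (p : Z ⟶ B) (e : B ⟶ W₁⟦(1 : ℤ)⟧),
      t.Vp B ∧ t.W W₁ ∧ t.U U' ∧ Triangle.mk d a w ∈ distTriang C ∧
      Triangle.mk (d ≫ g) β δ ∈ distTriang C ∧ Triangle.mk m p e ∈ distTriang C ∧
      a ≫ m = g ≫ β ∧ m ≫ δ = w := by
  obtain ⟨V', U', hV', hU', _, g, h, hT⟩ := t.exists_cone X
  obtain ⟨W₁, U₁, hW₁, hU₁, a, b, c, hT'⟩ := t.exists_cocone U'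
  obtain ⟨D, d, w, hD⟩ : ∃ (D : C) (d : D ⟶ U') (w : W₁ ⟶ D⟦(1 : ℤ)⟧),
      Triangle.mk d a w ∈ distTriang C := ⟨_, _, _, inv_rot_of_distTriang _ hT'⟩
  obtain ⟨Z, β, δ, hZ⟩ := distinguished_cocone_triangle (d ≫ g)
  let o := someOctahedron rfl hD (rot_of_distTriang _ hT) hZ
  exact ⟨D, U', W₁, _, Z, d, a, w, g, β, δ, _, _, _, t.Vp_shift hV',
    ⟨t.U_ext _ hT' hU' hU₁, hW₁⟩, hU', hD, hZ, o.mem, o.comm₁, o.comm₂⟩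

/-- If `g : X ⟶ Y` vanishes in `C/[W]` after precomposition with every morphism from an object
of `C⁻`, then `g` factors through `V`. -/
lemma factorsThrough_V_of_minus {X Y : C} (g : X ⟶ Y)
    (hg : ∀ ⦃Z : C⦄, t.minus Z → ∀ k : Z ⟶ X, t.W.FactorsThrough (k ≫ g)) :
    t.V.FactorsThrough g := by
  obtain ⟨A, V₁, W₁, V', Z, a, b, c, s, α, δ, i, m, e, hA, hW, hV', hT, hZ, hi, h₄, h₃⟩ :=
    t.exists_coreflection_square X
  obtain ⟨W₀, hW₀, x, y, hxy⟩ := hg ⟨_, _, _, _, _, hi, hA, hW⟩ α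
  obtain ⟨x', rfl⟩ := distTriang_desc₂ hi x (t.zero_of_Um_V hA hW₀.2 _)
  -- The square on `Z`, `X`, `W₁`, `V'` behaves as a weak pushout: `g` on `X` and `x' ≫ y` on `W₁`
  -- agree on `Z`, so `g` should extend along `s` to `V'`. The rest builds this extension, first up
  -- to a term killed by `α`.
  have hq : m ≫ x' ≫ y = α ≫ g := by rw [← hxy, Category.assoc]
  have hδ : δ ≫ α⟦(1 : ℤ)⟧' = 0 := comp_distTriang_mor_zero₃₁ _ hZ
  have ha : a ≫ x' ≫ y = 0 := (shiftFunctor C (1 : ℤ)).map_injective (by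
    have : δ ≫ (m ≫ x' ≫ y)⟦(1 : ℤ)⟧' = 0 := by
      rw [hq, Functor.map_comp, reassoc_of% hδ, zero_comp]
    rw [Functor.map_comp, reassoc_of% h₃, Preadditive.neg_comp, neg_eq_zero] at this
    rw [Functor.map_comp, this, Functor.map_zero])
  obtain ⟨q, hq'⟩ := distTriang_desc₂ hT (x' ≫ y) ha
  obtain ⟨e, he⟩ := distTriang_desc₂ hZ (g - s ≫ q) (by
    rw [Preadditive.comp_sub, ← hq, hq', reassoc_of% h₄, sub_self])
  exact ⟨V', hV', s, c ≫ e + q, by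
    rw [Preadditive.comp_add, ← Category.assoc, ← he, sub_add_cancel]⟩

/-- If every composition of `f : A ⟶ B` with a morphism to an object of `C⁺` factors
through `V`, then `f` factors through `U * V`. -/
lemma factorsThrough_UV_of_plus {A B : C} (f : A ⟶ B)
    (hf : ∀ ⦃Z : C⦄, t.plus Z → ∀ k : B ⟶ Z, t.V.FactorsThrough (f ≫ k)) :
    (t.U.extensionProduct t.V).FactorsThrough f := by
  obtain ⟨D, U', W₁, V₁, Z, d, a, w, g, β, δ, m, p, e, hV₁, hW, hU', hD, hZ, hm, h₁, h₂⟩ :=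
    t.exists_reflection_square B
  have hβδ : β ≫ δ = 0 := comp_distTriang_mor_zero₂₃ _ hZ
  obtain ⟨V₀, hV₀, x, y, hxy⟩ := hf ⟨_, _, _, _, _, hm, hW, hV₁⟩ β
  -- Think of `U' ⟶ B ⊞ W₁ ⟶ Z` as a triangle with connecting map `δ ≫ d⟦1⟧'` (up to sign), and of
  -- `E` as its pullback along `y : V₀ ⟶ Z`; so `E` is in `U * V`. The maps `r` and `n` below play
  -- the role of the components of `E ⟶ B ⊞ W₁`.
  obtain ⟨E, i, q, hE⟩ := distinguished_cocone_triangle₂ (y ≫ δ ≫ d⟦(1 : ℤ)⟧')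
  obtain ⟨x', hx'⟩ := distTriang_lift₂ hE x (by
    rw [reassoc_of% hxy, reassoc_of% hβδ, zero_comp, comp_zero])
  have hqE : q ≫ y ≫ δ ≫ d⟦(1 : ℤ)⟧' = 0 := comp_distTriang_mor_zero₂₃ _ hE
  obtain ⟨n, hn⟩ : ∃ n : E ⟶ W₁, q ≫ y ≫ δ = n ≫ w :=
    Triangle.coyoneda_exact₁ _ hD (q ≫ y ≫ δ) (by
      change (q ≫ y ≫ δ) ≫ d⟦(1 : ℤ)⟧' = 0
      rw [Category.assoc, Category.assoc, hqE])
  obtain ⟨r, hr⟩ := distTriang_lift₂ hZ (q ≫ y - n ≫ m) (by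
    rw [Preadditive.sub_comp, Category.assoc, Category.assoc, h₂, hn, sub_self])
  have hfr : (f - x' ≫ r) ≫ β = x' ≫ n ≫ m := by
    rw [Preadditive.sub_comp, Category.assoc, ← hr, Preadditive.comp_sub, ← Category.assoc x' q,
      ← hx', hxy, sub_sub_cancel]
  -- What remains of `f` after subtracting `x' ≫ r` should come from `U'`: `k` cancels the `W₁`
  -- component, and `l` then absorbs the error killed by `β`.
  obtain ⟨k, hk⟩ := distTriang_lift₂ hD (x' ≫ n) (by
    rw [← h₂, ← Category.assoc, Category.assoc x', ← hfr, Category.assoc, hβδ, comp_zero])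
  obtain ⟨l, hl⟩ := distTriang_lift₁ hZ (f - x' ≫ r - k ≫ g) (by
    rw [Preadditive.sub_comp, hfr, Category.assoc, ← h₁, ← Category.assoc k, ← hk,
      Category.assoc, sub_self])
  refine ⟨U' ⊞ E, t.UV_biprod _ _ hU' ⟨_, _, _, _, _, hE, hU', hV₀⟩,
    biprod.lift (l ≫ d + k) x', biprod.desc g r, ?_⟩
  rw [biprod.lift_desc, Preadditive.add_comp, Category.assoc, ← hl]
  abel

/-! ### Morphisms killed by `L` and by `H` -/

/-- `R` is built from hom bijections; this square determines `R(f)`, since precomposition with `X ⟶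
X⁺` is injective on maps into `C⁺/[W]`. -/
lemma βQ_comp_R_map {X Y : t.AddQuotient} (f : X ⟶ Y) :
    t.βQ X ≫ (t.R.map f).hom = f ≫ t.βQ Y := by
  have h : t.reflEquiv X (t.plusObj Y) (t.R.map f) =
      f ≫ t.reflEquiv Y (t.plusObj Y) (𝟙 _) := Equiv.apply_symm_apply _ _
  change t.βQ X ≫ (t.R.map f).hom = f ≫ t.βQ Y ≫ 𝟙 _ at h
  rwa [Category.comp_id] at h

lemma L_map_comp_αQ {X Y : t.AddQuotient} (f : X ⟶ Y) :
    (t.L.map f).hom ≫ t.αQ Y = t.αQ X ≫ f := by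
  have h : (t.coreflEquiv (t.minusObj X) Y).symm (t.L.map f) =
      (t.coreflEquiv (t.minusObj X) X).symm (𝟙 _) ≫ f := Equiv.symm_apply_apply _ _
  change (t.L.map f).hom ≫ t.αQ Y = (𝟙 _ ≫ t.αQ X) ≫ f at h
  rwa [Category.id_comp] at h

/-- Composition with `Y⁻ ⟶ Y` is injective on maps from `C⁻/[W]`, and naturality moves the
coreflection to the source. -/
lemma L_map_eq_zero_iff {X Y : C} (g : X ⟶ Y) :
    t.L.map (t.π.map g) = 0 ↔ t.W.FactorsThrough ((t.corefl X).α ≫ g) := by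
  have h := t.L_map_comp_αQ (t.π.map g)
  rw [← π_map_eq_zero_iff, Functor.map_comp]
  change _ ↔ t.αQ (t.π.obj X) ≫ t.π.map g = 0
  rw [← h]
  constructor
  · intro h₀
    rw [h₀]
    exact zero_comp
  · intro h₀
    exact (t.αQ_bijective _ (t.π.obj Y)).1 (h₀.trans zero_comp.symm)

/-- `H(f) = 0` if and only if the composition `A ⟶ B ⟶ B⁺` factors through `V`. -/
lemma H_map_eq_zero_iff {A B : C} (f : A ⟶ B) :
    t.H.map f = 0 ↔ t.V.FactorsThrough (f ≫ (t.refl B).β) := by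
  obtain ⟨g, hg⟩ := (t.refl A).exists_fac (t.refl B).hobj (f ≫ (t.refl B).β)
  have hR : (t.R.map (t.π.map f)).hom = t.π.map g := by
    have : t.R.map (t.π.map f) = ⟨t.π.map g⟩ := by
      apply (t.βQ_bijective (t.π.obj A) (t.plusObj (t.π.obj B))).1
      exact (t.βQ_comp_R_map (t.π.map f)).trans
        ((t.π.map_comp _ _).symm.trans ((congrArg t.π.map hg.symm).trans (t.π.map_comp _ _)))
    rw [this]
  have hH : t.H.map f = 0 ↔ t.L.map (t.π.map g) = 0 := by
    rw [← hR]
    exact ⟨fun h => ObjectProperty.hom_ext _ (congrArg (fun k => k.hom) h),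
      fun h => ObjectProperty.hom_ext _ (congrArg (fun k => k.hom) h)⟩
  rw [hH, L_map_eq_zero_iff, ← hg]
  constructor
  · intro h
    have : t.V.FactorsThrough g := t.factorsThrough_V_of_minus g (fun Z hZ k => by
      obtain ⟨k', rfl⟩ := (t.corefl (t.refl A).obj).exists_fac hZ k
      obtain ⟨W₁, hW₁, x, y, hxy⟩ := h
      exact ⟨W₁, hW₁, k' ≫ x, y, by rw [Category.assoc, hxy, Category.assoc]⟩)
    obtain ⟨V₁, hV₁, x, y, rfl⟩ := this
    exact ⟨V₁, hV₁, (t.refl A).β ≫ x, y, Category.assoc _ _ _⟩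
  · rintro ⟨V₁, hV₁, x, y, hxy⟩
    obtain ⟨k, rfl⟩ := (t.refl A).exists_fac (t.V_le_plus _ hV₁) x
    -- The difference vanishes after `A ⟶ A⁺`, so it lies in `[W]` by uniqueness in the reflection;
    -- since `W ⊆ V`, `g` itself factors through `V`.
    have hky : t.W.FactorsThrough (g - k ≫ y) :=
      (t.refl A).factorsThrough (t.refl B).hobj _ ⟨0, ⟨t.U_zero, t.V_zero⟩, 0, 0, by
        rw [Preadditive.comp_sub, ← hxy, Category.assoc, sub_self, zero_comp]⟩
    obtain ⟨W₁, hW₁, a, b, hab⟩ := hky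
    have hg' : t.V.FactorsThrough g := by
      have := ObjectProperty.FactorsThrough.add t.V_biprod (P := t.V) ⟨W₁, hW₁.2, a, b, hab⟩
        ⟨V₁, hV₁, k, y, rfl⟩
      rwa [sub_add_cancel] at this
    obtain ⟨V₂, hV₂, a, b, rfl⟩ := hg'
    exact t.factorsThrough_W_of_minus (t.corefl _).hobj
      ⟨V₂, hV₂, (t.corefl _).α ≫ a, b, Category.assoc _ _ _⟩

/-- A morphism killed by `H` factors through `U * V`. -/
lemma factorsThrough_UV_of_H_map_eq_zero {A B : C} {f : A ⟶ B} (hf : t.H.map f = 0) :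
    (t.U.extensionProduct t.V).FactorsThrough f :=
  t.factorsThrough_UV_of_plus f (fun Z hZ k => by
    obtain ⟨V₁, hV₁, x, y, hxy⟩ := (t.H_map_eq_zero_iff f).1 hf
    obtain ⟨k', rfl⟩ := (t.refl B).exists_fac hZ k
    exact ⟨V₁, hV₁, x, y ≫ k', by rw [reassoc_of% hxy]⟩)

/-! ### The kernel of `H` -/

lemma H_kernel_iff (X : C) : t.H.kernel X ↔ t.H.map (𝟙 X) = 0 := by
  rw [Functor.map_id]
  exact IsZero.iff_id_eq_zero _

lemma UV_le_H_kernel : t.U.extensionProduct t.V ≤ t.H.kernel := fun X hX => by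
  rw [H_kernel_iff, H_map_eq_zero_iff]
  exact t.factorsThrough_V_of_UV hX (t.refl X).hobj _

/-- A morphism which factors through the kernel of `H` is killed by `H`. -/
lemma H_map_eq_zero_of_factorsThrough {A B : C} {f : A ⟶ B} (hf : t.H.kernel.FactorsThrough f) :
    t.H.map f = 0 := by
  obtain ⟨Z, hZ, a, b, rfl⟩ := hf
  rw [Functor.map_comp, IsZero.eq_of_src hZ (t.H.map b) 0, comp_zero]

/-- Replaces additivity of `H`: by the criterion it suffices that maps factoring through `V` are
closed under sums. -/
lemma H_map_sum_eq_zero {A B : C} {ι : Type*} (s : Finset ι) (f : ι → (A ⟶ B))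
    (hf : ∀ i ∈ s, t.H.map (f i) = 0) : t.H.map (∑ i ∈ s, f i) = 0 := by
  refine Finset.sum_induction f (fun g => t.H.map g = 0) (fun a b ha hb => ?_) ?_ hf
  · rw [H_map_eq_zero_iff] at ha hb ⊢
    rw [Preadditive.add_comp]
    exact ha.add t.V_biprod hb
  · rw [H_map_eq_zero_iff, zero_comp]
    exact ⟨0, t.V_zero, 0, 0, zero_comp⟩

lemma H_kernel_eq_addClosure : t.H.kernel = (t.U.extensionProduct t.V).addClosure := by
  ext X
  constructor
  · intro hX
    obtain ⟨Z, hZ, a, b, hab⟩ :=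
      t.factorsThrough_UV_of_H_map_eq_zero ((t.H_kernel_iff X).1 hX)
    -- One summand is enough: the factorization of `𝟙 X` makes `X` a retract of a single object of
    -- `U * V`.
    exact ⟨1, fun _ => Z, fun _ => hZ, ⟨{
      i := biproduct.lift (fun _ => a)
      r := biproduct.desc (fun _ => b)
      retract := by rw [biproduct.lift_desc, Fin.sum_univ_one, hab] }⟩⟩
  · rintro ⟨n, Y, hY, ⟨r⟩⟩
    have hsum : t.H.map (𝟙 (⨁ Y)) = 0 := by
      -- The identity of the biproduct is a sum of maps, each factoring through some `Y i`.
      rw [← biproduct.total]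
      exact t.H_map_sum_eq_zero _ _ (fun i _ => t.H_map_eq_zero_of_factorsThrough
        ⟨Y i, t.UV_le_H_kernel _ (hY i), _, _, rfl⟩)
    rw [H_kernel_iff, ← r.retract]
    exact t.H_map_eq_zero_of_factorsThrough ⟨_, (t.H_kernel_iff _).2 hsum, _, _, rfl⟩

end CotorsionPair

end CategoryTheory

theorem proposition5p10 {C : Type u} [Category.{v} C] [HasZeroObject C] [HasShift C ℤ]
    [Preadditive C] [∀ n : ℤ, (shiftFunctor C n).Additive] [Pretriangulated C] [IsTriangulated C]
    (t : CotorsionPair C) :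
    t.H.kernel = (t.U.extensionProduct t.V).addClosure ∧
      t.H.kernel.coneOf t.H.kernel = ⊤ ∧
      ∀ ⦃A B : C⦄ (f : A ⟶ B), t.H.map f = 0 ↔ t.H.kernel.FactorsThrough f := by
  refine ⟨t.H_kernel_eq_addClosure, ?_, fun A B f =>
    ⟨fun hf => ?_, t.H_map_eq_zero_of_factorsThrough⟩⟩
  · ext X
    refine ⟨fun _ => trivial, fun _ => ?_⟩
    obtain ⟨V₁, U₁, hV₁, hU₁, a, b, c, hT⟩ := t.exists_cone X
    exact ⟨V₁, U₁, t.UV_le_H_kernel _ (ObjectProperty.le_extensionProduct_right _ _ hV₁),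
      t.UV_le_H_kernel _ (ObjectProperty.le_extensionProduct_left _ _ hU₁), a, b, c, hT⟩
  · obtain ⟨Z, hZ, a, b, hab⟩ := t.factorsThrough_UV_of_H_map_eq_zero hf
    exact ⟨Z, t.UV_le_H_kernel _ hZ, a, b, hab⟩
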